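/- Fix $p\in\mathbb N$ and a bandwidth $s>0$. For a point cloud $x_1,\dots,x_n\in\mathbb R^p$ let $A_{ij}=\exp(-\|x_i-x_j\|_2^2/s^2)$, let $D$ be the diagonal matrix of the row sums of $A$, put $K=D^{-1}AD^{-1}$, let $\mathcal D$ be the diagonal matrix of the row sums of $K$, and let $\mathcal L(x)=I_n-\mathcal D^{-1}K$ be the random walk graph Laplacian. All eigenvalues of $\mathcal L(x)$ are real; list them with multiplicity as $\lambda_1(x)\le\dots\le\lambda_n(x)$. For every $n$ let $y_1,\dots,y_n\in\mathbb R^p$ (depending on $n$) be clean data points with $\|y_i\|_2\le R$, where $R$ does not depend on $n$, and let $\eta_1,\dots,\eta_n$ be independent, identically distributed random vectors in $\mathbb R^p$ that are centered sub-Gaussian with variance proxy $\varepsilon=\varepsilon_n\ge 0$, i.e. $\mathbb E\exp(\alpha^\top\eta_i)\le\exp(\|\alpha\|_2^2\varepsilon^2/2)$ for all $\alpha\in\mathbb R^p$. Assume that there is a constant $c>0$ with $\varepsilon_n<\sqrt c/\sqrt{n\log n}$ for all $n\ge 2$. Let $\overline{\mathcal L}=\mathcal L(y)$ with eigenvalues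 $\bar\lambda_1\le\dots\le\bar\lambda_n$ be the clean Laplacian, and $\mathcal L=\mathcal L(y+\eta)$ with eigenvalues $\lambda_1\le\dots\le\lambda_n$ the noisy Laplacian, constructed from the points $y_i+\eta_i$. Let $m$ be fixed (independent of $n$) and assume that for each $1\le i\le m-1$ $$|\bar\lambda_i-\bar\lambda_{i+1}|=\omega(n^{-1/2})\qquad(n\to\infty).$$ Then for each fixed $1\le i\le m-1$ there are a deterministic sequence $\delta_n\to 0$ and events $E_n$ with $\mathbb P(E_n)\ge 1-o(1)$ such that on $E_n$ the following holds: whenever $\psi_i$ and $\bar\psi_i$ are eigenvectors of $\mathcal L$ and $\overline{\mathcal L}$ with eigenvalues $\lambda_i$ and $\bar\lambda_i$, respectively, normalized by $\|\psi_i\|_2=\|\bar\psi_i\|_2=1$, there is a sign $\tau_i\in\{\pm1\}$ (which may depend on the realization of the noise) with $$\|\psi_i-\tau_i\bar\psi_i\|_2\le\delta_n .$$ In short, $\|\psi_i-\tau_i\bar\psi_i\|_2=o(1)$ with probability at least $1-o(1)$. -/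

import Mathlib

open MeasureTheory ProbabilityTheory Filter Topology Asymptotics

noncomputable section

namespace NoisyLaplacian

/-- The Gaussian kernel `z ↦ exp (-‖z‖² / s²)` on `ℝ^p` with bandwidth `s`. -/
def gaussianKernel {p : ℕ} (s : ℝ) (z : EuclideanSpace ℝ (Fin p)) : ℝ :=
  Real.exp (-‖z‖ ^ 2 / s ^ 2)

/-- The kernel adjacency matrix of a point cloud. -/
def adjacency {p n : ℕ} (s : ℝ) (x : Fin n → EuclideanSpace ℝ (Fin p)) :
    Matrix (Fin n) (Fin n) ℝ :=
  Matrix.of fun i j => gaussianKernel s (x i - x j)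

/-- The diagonal matrix of the row sums of `M`. -/
def degreeMatrix {n : ℕ} (M : Matrix (Fin n) (Fin n) ℝ) : Matrix (Fin n) (Fin n) ℝ :=
  Matrix.diagonal fun i => ∑ j, M i j

/-- The normalized adjacency matrix `D⁻¹ A D⁻¹`, where `D` is the degree matrix of `A`. -/
def normalizedAdjacency {p n : ℕ} (s : ℝ) (x : Fin n → EuclideanSpace ℝ (Fin p)) :
    Matrix (Fin n) (Fin n) ℝ :=
  (degreeMatrix (adjacency s x))⁻¹ * adjacency s x * (degreeMatrix (adjacency s x))⁻¹

/-- The random walk graph Laplacian `I - 𝒟⁻¹ K`, where `K` is the normalized adjacency matrix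
and `𝒟` is the degree matrix of `K`. -/
def rwLaplacian {p n : ℕ} (s : ℝ) (x : Fin n → EuclideanSpace ℝ (Fin p)) :
    Matrix (Fin n) (Fin n) ℝ :=
  1 - (degreeMatrix (normalizedAdjacency s x))⁻¹ * normalizedAdjacency s x

/-- The `i`-th smallest real eigenvalue of `M`, where `i = 1, 2, …` and eigenvalues are repeated
according to algebraic multiplicity. The value is `0` if there is no such eigenvalue; for
`M = rwLaplacian s x` all `n` eigenvalues are real (see `card_roots_charpoly_rwLaplacian`), so that
this happens only if `i` is not in `{1, …, n}`. -/
def nthEigenvalue {n : ℕ} (M : Matrix (Fin n) (Fin n) ℝ) (i : ℕ) : ℝ :=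
  (M.charpoly.roots.sort (· ≤ ·)).getD (i - 1) 0

/-- `v` is an eigenvector of `M` with eigenvalue `μ` and Euclidean norm `1`. -/
def IsUnitEigenvector {n : ℕ} (M : Matrix (Fin n) (Fin n) ℝ) (μ : ℝ)
    (v : EuclideanSpace ℝ (Fin n)) : Prop :=
  ‖v‖ = 1 ∧ M.mulVec v.ofLp = μ • v.ofLp

/-- `X` is a sub-Gaussian random vector with variance proxy `ε` and center `μ`. Integrability says
that the expectation in the inequality is finite. -/
structure IsSubGaussianVector {Ω : Type*} [MeasurableSpace Ω] {p : ℕ}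
    (X : Ω → EuclideanSpace ℝ (Fin p)) (ε : ℝ) (μ : EuclideanSpace ℝ (Fin p))
    (P : Measure Ω) : Prop where
  integrable_exp : ∀ a : EuclideanSpace ℝ (Fin p),
    Integrable (fun ω => Real.exp (inner ℝ a (X ω - μ))) P
  integral_exp_le : ∀ a : EuclideanSpace ℝ (Fin p),
    ∫ ω, Real.exp (inner ℝ a (X ω - μ)) ∂P ≤ Real.exp (‖a‖ ^ 2 * ε ^ 2 / 2)

/-! Facts showing that the eigenvalues and eigenvectors of the Laplacians are well defined. -/

theorem adjacency_pos {p n : ℕ} (s : ℝ) (x : Fin n → EuclideanSpace ℝ (Fin p)) (i j : Fin n) :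
    0 < adjacency s x i j := Real.exp_pos _

theorem adjacency_comm {p n : ℕ} (s : ℝ) (x : Fin n → EuclideanSpace ℝ (Fin p)) (i j : Fin n) :
    adjacency s x i j = adjacency s x j i := by
  simp [adjacency, gaussianKernel, norm_sub_rev]

theorem degreeMatrix_inv {n : ℕ} (M : Matrix (Fin n) (Fin n) ℝ) (h : ∀ i j, 0 < M i j) :
    (degreeMatrix M)⁻¹ = Matrix.diagonal fun i => (∑ j, M i j)⁻¹ := by
  apply Matrix.inv_eq_right_inv
  rw [degreeMatrix, Matrix.diagonal_mul_diagonal, ← Matrix.diagonal_one]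
  congr 1
  funext i
  exact mul_inv_cancel₀ (Finset.sum_pos (fun j _ => h i j) ⟨i, Finset.mem_univ i⟩).ne'

theorem normalizedAdjacency_apply {p n : ℕ} (s : ℝ) (x : Fin n → EuclideanSpace ℝ (Fin p))
    (i j : Fin n) : normalizedAdjacency s x i j =
      (∑ k, adjacency s x i k)⁻¹ * adjacency s x i j * (∑ k, adjacency s x j k)⁻¹ := by
  rw [normalizedAdjacency, degreeMatrix_inv _ (adjacency_pos s x), Matrix.mul_diagonal,
    Matrix.diagonal_mul]

theorem normalizedAdjacency_pos {p n : ℕ} (s : ℝ) (x : Fin n → EuclideanSpace ℝ (Fin p))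
    (i j : Fin n) : 0 < normalizedAdjacency s x i j := by
  have h : ∀ i, 0 < ∑ k, adjacency s x i k := fun i =>
    Finset.sum_pos (fun k _ => adjacency_pos s x i k) ⟨i, Finset.mem_univ i⟩
  rw [normalizedAdjacency_apply]
  exact mul_pos (mul_pos (inv_pos.2 (h i)) (adjacency_pos s x i j)) (inv_pos.2 (h j))

theorem normalizedAdjacency_comm {p n : ℕ} (s : ℝ) (x : Fin n → EuclideanSpace ℝ (Fin p))
    (i j : Fin n) : normalizedAdjacency s x i j = normalizedAdjacency s x j i := by
  rw [normalizedAdjacency_apply, normalizedAdjacency_apply, adjacency_comm s x i j]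
  ring

/-- All eigenvalues of the random walk Laplacian are real: its characteristic polynomial has `n`
real roots, counted with multiplicity. -/
theorem card_roots_charpoly_rwLaplacian {p n : ℕ} (s : ℝ)
    (x : Fin n → EuclideanSpace ℝ (Fin p)) : (rwLaplacian s x).charpoly.roots.card = n := by
  set K := normalizedAdjacency s x with hK
  set d : Fin n → ℝ := fun i => ∑ j, K i j with hd
  have hdpos : ∀ i, 0 < d i := fun i =>
    Finset.sum_pos (fun k _ => normalizedAdjacency_pos s x i k) ⟨i, Finset.mem_univ i⟩
  have hsq : ∀ i, √(d i) ≠ 0 := fun i => (Real.sqrt_pos.2 (hdpos i)).ne'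
  set T : Matrix (Fin n) (Fin n) ℝ := Matrix.diagonal fun i => √(d i) with hT
  set U : Matrix (Fin n) (Fin n) ℝ := Matrix.diagonal fun i => (√(d i))⁻¹ with hU
  have hTU : T * U = 1 := by
    rw [hT, hU, Matrix.diagonal_mul_diagonal, ← Matrix.diagonal_one]
    congr 1
    funext i
    exact mul_inv_cancel₀ (hsq i)
  have hUT : U * T = 1 := mul_eq_one_comm.1 hTU
  have hL : rwLaplacian s x = U * (1 - U * K * U) * T := by
    rw [mul_sub, sub_mul, mul_one, hUT, rwLaplacian, ← hK,
      degreeMatrix_inv _ (normalizedAdjacency_pos s x)]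
    congr 1
    have : U * (U * K * U) * T = (U * U) * K * (U * T) := by simp only [mul_assoc]
    rw [this, hUT, mul_one, hU, Matrix.diagonal_mul_diagonal]
    congr 2
    funext i
    rw [← mul_inv, Real.mul_self_sqrt (hdpos i).le]
  have hchar : (rwLaplacian s x).charpoly = (1 - U * K * U).charpoly := by
    rw [hL, Matrix.charpoly_mul_comm, ← mul_assoc, hTU, one_mul]
  have hherm : (1 - U * K * U).IsHermitian := by
    ext i j
    have hc := normalizedAdjacency_comm s x i j
    simp only [hU, Matrix.conjTranspose_apply, Matrix.sub_apply, Matrix.mul_diagonal,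
      Matrix.diagonal_mul, star_trivial, hK, hc]
    congr 1
    · simp [Matrix.one_apply, eq_comm]
    · ring
  rw [hchar, hherm.roots_charpoly_eq_eigenvalues]
  simp

/-- Every eigenvalue in the enumeration has a unit eigenvector. -/
theorem exists_isUnitEigenvector {p n : ℕ} (s : ℝ) (x : Fin n → EuclideanSpace ℝ (Fin p))
    {i : ℕ} (h1 : 1 ≤ i) (hn : i ≤ n) :
    ∃ v, IsUnitEigenvector (rwLaplacian s x) (nthEigenvalue (rwLaplacian s x) i) v := by
  set M := rwLaplacian s x with hM
  have hlen : i - 1 < (M.charpoly.roots.sort (· ≤ ·)).length := by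
    rw [Multiset.length_sort, hM, card_roots_charpoly_rwLaplacian]
    omega
  have hmem : nthEigenvalue M i ∈ M.charpoly.roots := by
    rw [nthEigenvalue, List.getD_eq_getElem _ _ hlen]
    exact (Multiset.mem_sort (· ≤ ·)).1 (List.getElem_mem hlen)
  have hroot := (Polynomial.mem_roots'.1 hmem).2
  have hdet : (Matrix.scalar (Fin n) (nthEigenvalue M i) - M).det = 0 := by
    rw [← Matrix.eval_charpoly]
    exact hroot
  obtain ⟨v, hv0, hv⟩ := Matrix.exists_mulVec_eq_zero_iff.2 hdet
  have hv' : M.mulVec v = nthEigenvalue M i • v := by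
    rw [Matrix.sub_mulVec, sub_eq_zero] at hv
    rw [← hv, Matrix.scalar_apply]
    ext k
    simp [Matrix.mulVec_diagonal]
  have hw : WithLp.toLp 2 v ≠ 0 := fun h => hv0 (by simpa using h)
  refine ⟨‖WithLp.toLp 2 v‖⁻¹ • WithLp.toLp 2 v, norm_smul_inv_norm hw, ?_⟩
  rw [WithLp.ofLp_smul, Matrix.mulVec_smul, hv', smul_comm]

end NoisyLaplacian

end

namespace NoisyLaplacian

/-! ### Perturbation of eigenvalues and eigenvectors -/

section Perturbation

variable {n : ℕ} {E : Type*} [NormedAddCommGroup E] [InnerProductSpace ℝ E]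

/-! The noise is small compared with the spectral gaps, and the Laplacian reacts to it in a
multiplicative way. A union bound over all coordinates of all noise vectors gives
$\max_i\|\eta_i\|\le\rho=O(n^{-1/2})$ outside an event of probability at most $2p/n$
(`measureReal_noise_compl_le`). On a bounded cloud every entry of the Gaussian kernel then changes
by a factor $e^{\pm t}$ with $t=O(\rho)$. Sums, products, inverses and square roots of positive
numbers respect such factors, so the entries of $\mathcal D^{-1}K$ and of $S=\mathcal
D^{-1/2}K\mathcal D^{-1/2}$ change by at most $e^{\pm 6t}$.

A relative entrywise error becomes an operator norm error without any loss in $n$: $S$ is positive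
with norm at most 1, so a matrix dominated entrywise by $\theta S$ has norm at most $\theta$
(`norm_toEuclideanLin_le`). Here $\theta=e^{6t}-1$. Weyl's inequality moves each ordered eigenvalue
by at most $\theta$.

For eigenvectors, the noisy $\psi$ is transported by the clean weight $T=\mathcal D^{1/2}$. Then
$T\psi$ is an approximate eigenvector of the clean symmetric matrix $I-S$ with relative residual at
most $2\theta$, and a gap $g$ puts it within $2\theta\|T\psi\|/g$ of the line of $T\bar\psi$
(`norm_sub_proj_le`). Since the condition number of $T$ is bounded in terms of $R/s$ alone, undoing
$T$ and fixing the sign gives an error $O(\rho/g)$, which tends to 0 because $g=\omega(n^{-1/2})$.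
-/

theorem inner_basis_apply (b : OrthonormalBasis (Fin n) ℝ E) (e : Fin n → ℝ) (f : E →ₗ[ℝ] E)
    (hf : ∀ j, f (b j) = e j • b j) (v : E) (j : Fin n) :
    inner ℝ (b j) (f v) = e j * inner ℝ (b j) v := by
  conv_lhs => rw [← b.sum_repr v]
  simp only [map_sum, map_smul, hf, inner_sum, inner_smul_right, b.inner_eq_ite,
    OrthonormalBasis.repr_apply_apply]
  simp [mul_comm]

/-- An approximate eigenvector is close to the eigenspace of a separated eigenvalue. -/
theorem norm_sub_proj_le (b : OrthonormalBasis (Fin n) ℝ E) (e : Fin n → ℝ) (f : E →ₗ[ℝ] E)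
    (hf : ∀ j, f (b j) = e j • b j) (μ g : ℝ) (hg : 0 ≤ g) (k : Fin n)
    (hgap : ∀ j, j ≠ k → g ≤ |e j - μ|) (v : E) :
    g * ‖v - inner ℝ (b k) v • b k‖ ≤ ‖f v - μ • v‖ := by
  refine le_of_sq_le_sq ?_ (norm_nonneg _)
  -- Compare coefficients in the basis: `f v - μ • v` has $j$-th coefficient $(e_j-\mu)\langle
  -- b_j,v\rangle$, and the $k$-th coefficient on the left is zero.
  rw [mul_pow, ← b.sum_sq_inner_right, ← b.sum_sq_inner_right (f v - μ • v), Finset.mul_sum]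
  refine Finset.sum_le_sum fun j _ => ?_
  rw [inner_sub_right, inner_sub_right, inner_basis_apply b e f hf, inner_smul_right,
    inner_smul_right, b.inner_eq_ite]
  by_cases h : j = k
  · subst h
    simpa using sq_nonneg _
  · rw [if_neg h, mul_zero, sub_zero, ← sub_mul, mul_pow]
    refine mul_le_mul_of_nonneg_right ?_ (sq_nonneg _)
    rw [← sq_abs (e j - μ)]
    exact pow_le_pow_left₀ hg (hgap j h) 2

theorem inner_self_apply (b : OrthonormalBasis (Fin n) ℝ E) (e : Fin n → ℝ) (f : E →ₗ[ℝ] E)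
    (hf : ∀ j, f (b j) = e j • b j) (v : E) :
    inner ℝ v (f v) = ∑ j, e j * inner ℝ (b j) v ^ 2 := by
  rw [← b.sum_inner_mul_inner]
  refine Finset.sum_congr rfl fun j _ => ?_
  rw [inner_basis_apply b e f hf, real_inner_comm]
  ring

/-- Weyl's inequality: the ordered eigenvalues are monotone in the quadratic form. -/
theorem eigenvalue_le_add (b b' : OrthonormalBasis (Fin n) ℝ E) (e e' : Fin n → ℝ)
    (he : Monotone e) (he' : Monotone e') (f f' : E →ₗ[ℝ] E)
    (hf : ∀ j, f (b j) = e j • b j) (hf' : ∀ j, f' (b' j) = e' j • b' j) (θ : ℝ)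
    (hle : ∀ v, inner ℝ v (f' v) ≤ inner ℝ v (f v) + θ * ‖v‖ ^ 2) (k : Fin n) :
    e' k ≤ e k + θ := by
  -- Courant–Fischer by dimension count: orthogonality to `b j` for $j>k$ and to `b' j` for $j<k$ is
  -- only $n-1$ conditions. A nonzero solution has its form for `f` at most `e k` and its form for
  -- `f'` at least `e' k`, relative to $\|v\|^2$.
  let φ : E →ₗ[ℝ] ({j : Fin n // j ≠ k} → ℝ) := LinearMap.pi fun j =>
    if k < j.1 then (innerSL ℝ (b j.1)).toLinearMap else (innerSL ℝ (b' j.1)).toLinearMap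
  have : FiniteDimensional ℝ E := b.toBasis.finiteDimensional_of_finite
  have hfin : Module.finrank ℝ E = n := by
    simpa using Module.finrank_eq_card_basis b.toBasis
  have hlt : Module.finrank ℝ ({j : Fin n // j ≠ k} → ℝ) < Module.finrank ℝ E := by
    rw [Module.finrank_fintype_fun_eq_card, hfin, Fintype.card_subtype_compl,
      Fintype.card_subtype_eq, Fintype.card_fin]
    have := k.pos
    omega
  obtain ⟨v, hv, hv0⟩ := (Submodule.ne_bot_iff _).1 (LinearMap.ker_ne_bot_of_finrank_lt hlt (f := φ))
  have hφ : ∀ j (h : j ≠ k), φ v ⟨j, h⟩ = 0 := fun j h => by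
    rw [LinearMap.mem_ker.1 hv]; rfl
  have h1 : ∀ j, k < j → inner ℝ (b j) v = 0 := fun j h => by
    simpa [φ, h] using hφ j h.ne'
  have h2 : ∀ j, j < k → inner ℝ (b' j) v = 0 := fun j h => by
    simpa [φ, not_lt.2 h.le] using hφ j h.ne
  have hup : inner ℝ v (f v) ≤ e k * ‖v‖ ^ 2 := by
    rw [inner_self_apply b e f hf, ← b.sum_sq_inner_right, Finset.mul_sum]
    refine Finset.sum_le_sum fun j _ => ?_
    rcases le_or_gt j k with h | h
    · exact mul_le_mul_of_nonneg_right (he h) (sq_nonneg _)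
    · simp [h1 j h]
  have hlow : e' k * ‖v‖ ^ 2 ≤ inner ℝ v (f' v) := by
    rw [inner_self_apply b' e' f' hf', ← b'.sum_sq_inner_right, Finset.mul_sum]
    refine Finset.sum_le_sum fun j _ => ?_
    rcases le_or_gt k j with h | h
    · exact mul_le_mul_of_nonneg_right (he' h) (sq_nonneg _)
    · simp [h2 j h]
  have hpos : 0 < ‖v‖ ^ 2 := by positivity
  refine le_of_mul_le_mul_right ?_ hpos
  linarith [hle v]

/-- By Cauchy–Schwarz a norm bound on `f' - f` bounds the difference of the quadratic forms from
both sides, so the one-sided inequality applies in both directions. -/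
theorem abs_eigenvalue_sub_le (b b' : OrthonormalBasis (Fin n) ℝ E) (e e' : Fin n → ℝ)
    (he : Monotone e) (he' : Monotone e') (f f' : E →ₗ[ℝ] E)
    (hf : ∀ j, f (b j) = e j • b j) (hf' : ∀ j, f' (b' j) = e' j • b' j) (θ : ℝ)
    (hle : ∀ v, ‖f' v - f v‖ ≤ θ * ‖v‖) (k : Fin n) : |e' k - e k| ≤ θ := by
  have key : ∀ v, |inner ℝ v (f' v) - inner ℝ v (f v)| ≤ θ * ‖v‖ ^ 2 := fun v => by
    rw [← inner_sub_right]
    calc _ ≤ ‖v‖ * ‖f' v - f v‖ := abs_real_inner_le_norm _ _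
      _ ≤ ‖v‖ * (θ * ‖v‖) := by gcongr; exact hle v
      _ = _ := by ring
  rw [abs_le]
  constructor
  · have := eigenvalue_le_add b' b e' e he' he f' f hf' hf θ
      (fun v => by linarith [(abs_le.1 (key v)).1]) k
    linarith
  · have := eigenvalue_le_add b b' e e' he he' f f' hf hf' θ
      (fun v => by linarith [(abs_le.1 (key v)).2]) k
    linarith

/-- A unit vector close to a multiple of another unit vector is close to it up to sign. -/
theorem exists_sign_norm_sub_le {u w : E} (hu : ‖u‖ = 1) (hw : ‖w‖ = 1) {a r : ℝ}
    (h : ‖u - a • w‖ ≤ r) : ∃ τ : ℝ, (τ = 1 ∨ τ = -1) ∧ ‖u - τ • w‖ ≤ 2 * r := by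
  -- Both vectors are unit, so the reverse triangle inequality forces $|a|$ near 1. Replacing `a` by
  -- its sign costs another `r`, hence the factor 2.
  have h1 : abs (1 - |a|) ≤ r := by
    have := abs_norm_sub_norm_le u (a • w)
    rw [norm_smul, hu, hw, mul_one, Real.norm_eq_abs] at this
    exact this.trans h
  have main : ∀ τ : ℝ, |a - τ| = abs (1 - |a|) → ‖u - τ • w‖ ≤ 2 * r := fun τ hτ => by
    have : u - τ • w = (u - a • w) + (a - τ) • w := by rw [sub_smul]; abel
    rw [this]
    refine (norm_add_le _ _).trans ?_
    rw [norm_smul, hw, Real.norm_eq_abs, hτ]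
    linarith
  rcases le_total 0 a with ha | ha
  · exact ⟨1, Or.inl rfl, main 1 (by rw [abs_of_nonneg ha, abs_sub_comm])⟩
  · refine ⟨-1, Or.inr rfl, main (-1) ?_⟩
    rw [abs_of_nonpos ha]
    congr 1
    ring

end Perturbation

/-- The ordered eigenvalues of a symmetric matrix with an orthonormal eigenbasis. -/
theorem exists_sorted_eigenbasis {n : ℕ} (H : Matrix (Fin n) (Fin n) ℝ) (hH : H.IsHermitian) :
    ∃ (e : Fin n → ℝ) (b : OrthonormalBasis (Fin n) ℝ (EuclideanSpace ℝ (Fin n))),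
      Monotone e ∧ (∀ j, Matrix.toEuclideanLin H (b j) = e j • b j) ∧
      ∀ k : Fin n, nthEigenvalue H (k + 1) = e k := by
  set σ := Tuple.sort hH.eigenvalues with hσ
  have hmono : Monotone (hH.eigenvalues ∘ σ) := Tuple.monotone_sort _
  refine ⟨hH.eigenvalues ∘ σ, hH.eigenvectorBasis.reindex σ.symm, hmono, fun j => ?_, fun k => ?_⟩
  · rw [OrthonormalBasis.reindex_apply, Equiv.symm_symm]
    apply WithLp.ofLp_injective
    simpa using hH.mulVec_eigenvectorBasis (σ j)
  · have hroots : H.charpoly.roots = (List.ofFn (hH.eigenvalues ∘ σ) : Multiset ℝ) := by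
      rw [hH.roots_charpoly_eq_eigenvalues, ← Fin.univ_val_map,
        ← Multiset.map_map hH.eigenvalues σ, Multiset.map_univ_val_equiv σ]
      rfl
    have hsort : H.charpoly.roots.sort (· ≤ ·) = List.ofFn (hH.eigenvalues ∘ σ) := by
      rw [hroots, Multiset.coe_sort]
      exact List.mergeSort_eq_self (r := (· ≤ ·)) (by simpa using hmono.sortedLE_ofFn.pairwise)
    rw [nthEigenvalue, hsort, Nat.add_sub_cancel]
    simp

end NoisyLaplacian

namespace NoisyLaplacian

/-! ### Random walk Laplacians of general positive kernels -/

/-- The row sums of `K`. -/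
def rowSum {n : ℕ} (K : Matrix (Fin n) (Fin n) ℝ) (i : Fin n) : ℝ := ∑ j, K i j

/-- The symmetrization `𝒟^{-1/2} K 𝒟^{-1/2}`. -/
noncomputable def symNormalized {n : ℕ} (K : Matrix (Fin n) (Fin n) ℝ) :
    Matrix (Fin n) (Fin n) ℝ :=
  Matrix.of fun i j => (√(rowSum K i))⁻¹ * K i j * (√(rowSum K j))⁻¹

/-- The matrix `I - 𝒟⁻¹ K`. -/
noncomputable def kernelLaplacian {n : ℕ} (K : Matrix (Fin n) (Fin n) ℝ) :
    Matrix (Fin n) (Fin n) ℝ :=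
  1 - Matrix.of fun i j => (rowSum K i)⁻¹ * K i j

section Kernel

variable {n : ℕ} {K : Matrix (Fin n) (Fin n) ℝ}

theorem rowSum_pos (hK : ∀ i j, 0 < K i j) (i : Fin n) : 0 < rowSum K i :=
  Finset.sum_pos (fun j _ => hK i j) ⟨i, Finset.mem_univ i⟩

theorem sqrt_rowSum_pos (hK : ∀ i j, 0 < K i j) (i : Fin n) : 0 < √(rowSum K i) :=
  Real.sqrt_pos.2 (rowSum_pos hK i)

theorem symNormalized_pos (hK : ∀ i j, 0 < K i j) (i j : Fin n) : 0 < symNormalized K i j :=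
  mul_pos (mul_pos (inv_pos.2 (sqrt_rowSum_pos hK i)) (hK i j)) (inv_pos.2 (sqrt_rowSum_pos hK j))

theorem rwLaplacian_eq_kernelLaplacian {p : ℕ} (s : ℝ) (x : Fin n → EuclideanSpace ℝ (Fin p)) :
    rwLaplacian s x = kernelLaplacian (normalizedAdjacency s x) := by
  rw [rwLaplacian, kernelLaplacian, degreeMatrix_inv _ (normalizedAdjacency_pos s x)]
  congr 1
  ext i j
  rw [Matrix.diagonal_mul]
  rfl

theorem isHermitian_one_sub_symNormalized (hs : ∀ i j, K i j = K j i) :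
    (1 - symNormalized K).IsHermitian := by
  refine Matrix.isHermitian_one.sub ?_
  ext i j
  simp only [symNormalized, Matrix.conjTranspose_apply, Matrix.of_apply, star_trivial, hs j i]
  ring

/-- The two matrices are similar through $\mathcal D^{1/2}$, so ordered eigenvalues can be studied
on the symmetric one. -/
theorem charpoly_kernelLaplacian (hK : ∀ i j, 0 < K i j) :
    (kernelLaplacian K).charpoly = (1 - symNormalized K).charpoly := by
  set T : Matrix (Fin n) (Fin n) ℝ := Matrix.diagonal fun i => √(rowSum K i) with hT
  set U : Matrix (Fin n) (Fin n) ℝ := Matrix.diagonal fun i => (√(rowSum K i))⁻¹ with hU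
  have hTU : T * U = 1 := by
    rw [hT, hU, Matrix.diagonal_mul_diagonal, ← Matrix.diagonal_one]
    congr 1
    funext i
    exact mul_inv_cancel₀ (sqrt_rowSum_pos hK i).ne'
  have hUT : U * T = 1 := mul_eq_one_comm.1 hTU
  have hL : kernelLaplacian K = U * (1 - symNormalized K) * T := by
    rw [mul_sub, sub_mul, mul_one, hUT, kernelLaplacian]
    congr 1
    ext i j
    have h := (sqrt_rowSum_pos hK j).ne'
    have h' := Real.mul_self_sqrt (rowSum_pos hK i).le
    rw [hT, hU, Matrix.mul_diagonal, Matrix.diagonal_mul]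
    simp only [symNormalized, Matrix.of_apply]
    have h'' : (rowSum K i)⁻¹ = (√(rowSum K i))⁻¹ * (√(rowSum K i))⁻¹ := by rw [← mul_inv, h']
    rw [h'']
    field_simp
  rw [hL, Matrix.charpoly_mul_comm, ← mul_assoc, hTU, one_mul]

/-- Matrices dominated entrywise by `θ 𝒟^{-1/2} K 𝒟^{-1/2}` have operator norm at most `θ`. -/
theorem norm_toEuclideanLin_le (hK : ∀ i j, 0 < K i j) (hs : ∀ i j, K i j = K j i)
    {θ : ℝ} (hθ : 0 ≤ θ) {B : Matrix (Fin n) (Fin n) ℝ}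
    (hB : ∀ i j, |B i j| ≤ θ * symNormalized K i j) (v : EuclideanSpace ℝ (Fin n)) :
    ‖Matrix.toEuclideanLin B v‖ ≤ θ * ‖v‖ := by
  have hd := rowSum_pos hK
  have hrow : ∀ i, (Matrix.toEuclideanLin B v) i ^ 2 ≤
      θ ^ 2 * ∑ j, K i j * (v j ^ 2 * (rowSum K j)⁻¹) := fun i => by
    have h1 : |(Matrix.toEuclideanLin B v) i| ≤
        θ * (√(rowSum K i))⁻¹ * ∑ j, K i j * ((√(rowSum K j))⁻¹ * |v j|) := by
      rw [Finset.mul_sum]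
      change |∑ j, B i j * v j| ≤ _
      refine (Finset.abs_sum_le_sum_abs (fun j => B i j * v j) _).trans
        (Finset.sum_le_sum fun j _ => ?_)
      rw [abs_mul]
      refine (mul_le_mul_of_nonneg_right (hB i j) (abs_nonneg _)).trans_eq ?_
      simp only [symNormalized, Matrix.of_apply]
      ring
    -- Cauchy–Schwarz with the weights `K i j`, as in Schur's test.
    have h2 : (∑ j, K i j * ((√(rowSum K j))⁻¹ * |v j|)) ^ 2 ≤
        rowSum K i * ∑ j, K i j * (v j ^ 2 * (rowSum K j)⁻¹) := by
      refine Finset.sum_sq_le_sum_mul_sum_of_sq_le_mul _ (fun j _ => (hK i j).le)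
        (fun j _ => mul_nonneg (hK i j).le (mul_nonneg (sq_nonneg _) (inv_nonneg.2 (hd j).le)))
        fun j _ => ?_
      rw [mul_pow, mul_pow, inv_pow, Real.sq_sqrt (hd j).le, sq_abs]
      exact le_of_eq (by ring)
    rw [← sq_abs]
    calc _ ≤ (θ * (√(rowSum K i))⁻¹ * ∑ j, K i j * ((√(rowSum K j))⁻¹ * |v j|)) ^ 2 :=
          pow_le_pow_left₀ (abs_nonneg _) h1 2
      _ = θ ^ 2 * (rowSum K i)⁻¹ * (∑ j, K i j * ((√(rowSum K j))⁻¹ * |v j|)) ^ 2 := by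
          rw [mul_pow, mul_pow, inv_pow, Real.sq_sqrt (hd i).le]
      _ ≤ θ ^ 2 * (rowSum K i)⁻¹ * (rowSum K i * ∑ j, K i j * (v j ^ 2 * (rowSum K j)⁻¹)) :=
          mul_le_mul_of_nonneg_left h2 (mul_nonneg (sq_nonneg _) (inv_nonneg.2 (hd i).le))
      _ = _ := by
          have := (hd i).ne'
          field_simp
  refine le_of_sq_le_sq ?_ (mul_nonneg hθ (norm_nonneg _))
  rw [mul_pow, EuclideanSpace.real_norm_sq_eq, EuclideanSpace.real_norm_sq_eq]
  refine (Finset.sum_le_sum fun i _ => hrow i).trans_eq ?_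
  -- After exchanging the sums, symmetry turns the column sums of `K` into row sums, which cancel
  -- the weights.
  rw [← Finset.mul_sum, Finset.sum_comm]
  congr 1
  refine Finset.sum_congr rfl fun j _ => ?_
  rw [← Finset.sum_mul, Finset.sum_congr rfl fun i _ => hs i j]
  change rowSum K j * _ = _
  have := (hd j).ne'
  field_simp

end Kernel

/-! ### Multiplicative closeness -/

/-- `a` and `b` agree up to a factor `exp t`. -/
def MulClose (t a b : ℝ) : Prop := a ≤ Real.exp t * b ∧ b ≤ Real.exp t * a

namespace MulClose

variable {t u a b c d : ℝ}

theorem mul (h : MulClose t a b) (h' : MulClose u c d) (ha : 0 < a) (hb : 0 < b) (hc : 0 < c)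
    (hd : 0 < d) : MulClose (t + u) (a * c) (b * d) := by
  refine ⟨?_, ?_⟩ <;> rw [Real.exp_add, mul_mul_mul_comm]
  · exact mul_le_mul h.1 h'.1 hc.le (by positivity)
  · exact mul_le_mul h.2 h'.2 hd.le (by positivity)

theorem inv (h : MulClose t a b) (ha : 0 < a) (hb : 0 < b) : MulClose t a⁻¹ b⁻¹ := by
  obtain ⟨h1, h2⟩ := h
  constructor <;> field_simp <;> rwa [mul_comm]

theorem sqrt (h : MulClose t a b) : MulClose (t / 2) √a √b := by
  have he : Real.exp (t / 2) = √(Real.exp t) := Real.exp_half t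
  refine ⟨?_, ?_⟩ <;> rw [he, ← Real.sqrt_mul (Real.exp_pos t).le]
  · exact Real.sqrt_le_sqrt h.1
  · exact Real.sqrt_le_sqrt h.2

theorem sum {ι : Type*} (s : Finset ι) {f g : ι → ℝ} (h : ∀ i ∈ s, MulClose t (f i) (g i)) :
    MulClose t (∑ i ∈ s, f i) (∑ i ∈ s, g i) := by
  constructor <;> rw [Finset.mul_sum]
  · exact Finset.sum_le_sum fun i hi => (h i hi).1
  · exact Finset.sum_le_sum fun i hi => (h i hi).2

theorem exp (h : |a - b| ≤ t) : MulClose t (Real.exp a) (Real.exp b) := by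
  rw [abs_le] at h
  constructor <;> rw [← Real.exp_add] <;> apply Real.exp_le_exp.2 <;> linarith

/-- The upper deviation is immediate; the lower one is at most $(1-e^{-t})a$, and $1-e^{-t}\le
e^t-1$ because $e^t+e^{-t}\ge 2$. -/
theorem abs_sub_le (h : MulClose t a b) (ha : 0 < a) : |b - a| ≤ (Real.exp t - 1) * a := by
  have h1 : b - a ≤ (Real.exp t - 1) * a := by linarith [h.2]
  refine abs_le.2 ⟨?_, h1⟩
  have h2 : (Real.exp t)⁻¹ * a ≤ b := (inv_mul_le_iff₀ (Real.exp_pos t)).2 h.1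
  have h3 : 2 ≤ Real.exp t + (Real.exp t)⁻¹ := by
    have := Real.exp_pos t
    rw [← sub_nonneg]
    have : Real.exp t + (Real.exp t)⁻¹ - 2 = (Real.exp t - 1) ^ 2 * (Real.exp t)⁻¹ := by
      field_simp
      ring
    rw [this]
    positivity
  nlinarith

end MulClose

/-- The entry of `K` costs $t$. The degree costs another $t$, either at once or as two square roots
at $t/2$ each. -/
theorem mulClose_entries {n : ℕ} {K K' : Matrix (Fin n) (Fin n) ℝ} {t : ℝ}
    (hK : ∀ i j, 0 < K i j) (hK' : ∀ i j, 0 < K' i j) (h : ∀ i j, MulClose t (K i j) (K' i j))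
    (i j : Fin n) :
    MulClose (2 * t) ((rowSum K i)⁻¹ * K i j) ((rowSum K' i)⁻¹ * K' i j) ∧
    MulClose (2 * t) (symNormalized K i j) (symNormalized K' i j) := by
  have hd : ∀ i, MulClose t (rowSum K i) (rowSum K' i) := fun i =>
    MulClose.sum _ fun j _ => h i j
  have hp := rowSum_pos hK
  have hp' := rowSum_pos hK'
  have hq := sqrt_rowSum_pos hK
  have hq' := sqrt_rowSum_pos hK'
  constructor
  · have := ((hd i).inv (hp i) (hp' i)).mul (h i j) (inv_pos.2 (hp i)) (inv_pos.2 (hp' i))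
      (hK i j) (hK' i j)
    rwa [← two_mul] at this
  · have h1 := ((hd i).sqrt.inv (hq i) (hq' i)).mul (h i j) (inv_pos.2 (hq i))
      (inv_pos.2 (hq' i)) (hK i j) (hK' i j)
    have h2 := h1.mul ((hd j).sqrt.inv (hq j) (hq' j)) (mul_pos (inv_pos.2 (hq i)) (hK i j))
      (mul_pos (inv_pos.2 (hq' i)) (hK' i j)) (inv_pos.2 (hq j)) (inv_pos.2 (hq' j))
    have e : t / 2 + t + t / 2 = 2 * t := by ring
    rwa [e] at h2

end NoisyLaplacian

namespace NoisyLaplacian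

/-! ### Eigenvector perturbation for kernel Laplacians -/

theorem nthEigenvalue_kernelLaplacian {n : ℕ} {K : Matrix (Fin n) (Fin n) ℝ}
    (hK : ∀ i j, 0 < K i j) (i : ℕ) :
    nthEigenvalue (kernelLaplacian K) i = nthEigenvalue (1 - symNormalized K) i := by
  rw [nthEigenvalue, charpoly_kernelLaplacian hK, nthEigenvalue]

/-- Conjugation by `𝒟^{1/2}` turns the random walk Laplacian into the symmetric one. -/
theorem sqrt_rowSum_mul_kernelLaplacian {n : ℕ} {K : Matrix (Fin n) (Fin n) ℝ}
    (hK : ∀ i j, 0 < K i j) (v : Fin n → ℝ) (i : Fin n) :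
    √(rowSum K i) * (kernelLaplacian K).mulVec v i =
      (1 - symNormalized K).mulVec (fun j => √(rowSum K j) * v j) i := by
  rw [kernelLaplacian, Matrix.sub_mulVec, Matrix.sub_mulVec, Matrix.one_mulVec, Matrix.one_mulVec,
    Pi.sub_apply, Pi.sub_apply, mul_sub]
  congr 1
  simp only [Matrix.mulVec, dotProduct, symNormalized, Matrix.of_apply, Finset.mul_sum]
  refine Finset.sum_congr rfl fun j _ => ?_
  have h := (sqrt_rowSum_pos hK j).ne'
  have h' := Real.mul_self_sqrt (rowSum_pos hK i).le
  have h'' : (rowSum K i)⁻¹ = (√(rowSum K i))⁻¹ * (√(rowSum K i))⁻¹ := by rw [← mul_inv, h']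
  have h3 := (sqrt_rowSum_pos hK i).ne'
  rw [h'']
  field_simp

/-- The eigenvalues of Laplacians of close kernels are close. -/
theorem abs_nthEigenvalue_sub_le {n : ℕ} {K K' : Matrix (Fin n) (Fin n) ℝ}
    (hK : ∀ i j, 0 < K i j) (hs : ∀ i j, K i j = K j i)
    (hK' : ∀ i j, 0 < K' i j) (hs' : ∀ i j, K' i j = K' j i) {t : ℝ} (ht : 0 ≤ t)
    (h : ∀ i j, MulClose t (K i j) (K' i j)) (k : Fin n) :
    |nthEigenvalue (kernelLaplacian K') (k + 1) - nthEigenvalue (kernelLaplacian K) (k + 1)| ≤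
      Real.exp (2 * t) - 1 := by
  obtain ⟨e, b, he, hb, hn⟩ := exists_sorted_eigenbasis _ (isHermitian_one_sub_symNormalized hs)
  obtain ⟨e', b', he', hb', hn'⟩ :=
    exists_sorted_eigenbasis _ (isHermitian_one_sub_symNormalized hs')
  rw [nthEigenvalue_kernelLaplacian hK, nthEigenvalue_kernelLaplacian hK', hn, hn']
  refine abs_eigenvalue_sub_le b b' e e' he he' _ _ hb hb' _ (fun v => ?_) k
  rw [← LinearMap.sub_apply, ← map_sub]
  refine norm_toEuclideanLin_le hK hs ?_ (fun i j => ?_) v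
  · have := Real.one_le_exp (by positivity : 0 ≤ 2 * t)
    linarith
  · rw [sub_sub_sub_cancel_left, Matrix.sub_apply, abs_sub_comm]
    exact (mulClose_entries hK hK' h i j).2.abs_sub_le (symNormalized_pos hK i j)

/-- Unit eigenvectors of Laplacians of close kernels, belonging to an isolated eigenvalue, agree up
to a sign and a small error. -/
theorem exists_sign_eigenvector_sub_le {n : ℕ} {K K' : Matrix (Fin n) (Fin n) ℝ}
    (hK : ∀ i j, 0 < K i j) (hs : ∀ i j, K i j = K j i)
    (hK' : ∀ i j, 0 < K' i j) (hs' : ∀ i j, K' i j = K' j i) {t : ℝ} (ht : 0 ≤ t)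
    (h : ∀ i j, MulClose t (K i j) (K' i j)) {κ : ℝ} (hκ : 0 ≤ κ)
    (hd : ∀ i j, rowSum K i ≤ κ ^ 2 * rowSum K j) (k : Fin n) {g : ℝ} (hg : 0 < g)
    (hgap : ∀ j, j ≠ k → g ≤ |nthEigenvalue (kernelLaplacian K) (j + 1) -
      nthEigenvalue (kernelLaplacian K) (k + 1)|)
    {ψ φ : EuclideanSpace ℝ (Fin n)}
    (hψ : IsUnitEigenvector (kernelLaplacian K') (nthEigenvalue (kernelLaplacian K') (k + 1)) ψ)
    (hφ : IsUnitEigenvector (kernelLaplacian K) (nthEigenvalue (kernelLaplacian K) (k + 1)) φ) :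
    ∃ τ : ℝ, (τ = 1 ∨ τ = -1) ∧
      ‖ψ - τ • φ‖ ≤ 2 * (2 * (Real.exp (2 * t) - 1) * κ / g) := by
  have hθ : 0 ≤ Real.exp (2 * t) - 1 := by
    have := Real.one_le_exp (by positivity : 0 ≤ 2 * t)
    linarith
  set θ := Real.exp (2 * t) - 1 with hθdef
  have hweyl := abs_nthEigenvalue_sub_le hK hs hK' hs' ht h k
  rw [← hθdef] at hweyl
  set lam := nthEigenvalue (kernelLaplacian K) (k + 1)
  set lam' := nthEigenvalue (kernelLaplacian K') (k + 1)
  obtain ⟨e, b, -, hb, hn⟩ := exists_sorted_eigenbasis _ (isHermitian_one_sub_symNormalized hs)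
  have hgap' : ∀ j, j ≠ k → g ≤ |e j - lam| := fun j hj => by
    have := hgap j hj
    rwa [nthEigenvalue_kernelLaplacian hK, hn] at this
  set f := Matrix.toEuclideanLin (1 - symNormalized K)
  have hq := sqrt_rowSum_pos hK
  let T : EuclideanSpace ℝ (Fin n) →ₗ[ℝ] EuclideanSpace ℝ (Fin n) :=
    Matrix.toEuclideanLin (Matrix.diagonal fun i => √(rowSum K i))
  have hT : ∀ v i, T v i = √(rowSum K i) * v i := fun v i => by
    simp [T, Matrix.mulVec_diagonal]
  have hfT : ∀ v : EuclideanSpace ℝ (Fin n),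
      f (T v) = T (WithLp.toLp 2 ((kernelLaplacian K).mulVec v.ofLp)) := fun v => by
    ext i
    rw [hT]
    change (1 - symNormalized K).mulVec (T v).ofLp i = _ * (kernelLaplacian K).mulVec v.ofLp i
    rw [sqrt_rowSum_mul_kernelLaplacian hK]
    congr 1
    funext j
    exact hT v j
  -- the clean eigenvector
  have hφ0 : T φ = inner ℝ (b k) (T φ) • b k := by
    have h1 : f (T φ) = lam • T φ := by
      rw [hfT, hφ.2, WithLp.toLp_smul, map_smul]
    -- `T φ` is an exact eigenvector, so its residual vanishes and separation leaves only the
    -- component along `b k`.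
    have h2 := norm_sub_proj_le b e f hb lam g hg.le k hgap' (T φ)
    rw [h1, sub_self, norm_zero] at h2
    have h3 := nonpos_of_mul_nonpos_right h2 hg
    exact sub_eq_zero.1 (norm_le_zero_iff.1 h3)
  have hTinj : ∀ v, T v = 0 → v = 0 := fun v hv => by
    ext i
    have : T v i = 0 := by rw [hv]; rfl
    rw [hT] at this
    exact (mul_eq_zero.1 this).resolve_left (hq i).ne'
  have hc0 : inner ℝ (b k) (T φ) ≠ 0 := fun h0 => by
    rw [h0, zero_smul] at hφ0
    have := hφ.1
    rw [hTinj φ hφ0, norm_zero] at this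
    exact zero_ne_one this
  -- Chosen so that `T (a • φ)` is the orthogonal projection of `T ψ` to the line of `b k`.
  set a := inner ℝ (b k) (T ψ) / inner ℝ (b k) (T φ) with ha
  -- the noisy eigenvector
  have hres : ‖f (T ψ) - lam • T ψ‖ ≤ 2 * θ * ‖T ψ‖ := by
    -- $B=\mathcal D^{1/2}(\mathcal D'^{-1}K'-\mathcal D^{-1}K)\mathcal D^{-1/2}$: both Laplacians
    -- are conjugated by the clean weights, so the noisy symmetrization is not needed here.
    let B : Matrix (Fin n) (Fin n) ℝ := Matrix.of fun i j =>
      √(rowSum K i) * ((rowSum K' i)⁻¹ * K' i j - (rowSum K i)⁻¹ * K i j) * (√(rowSum K j))⁻¹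
    have hB : ∀ i j, |B i j| ≤ θ * symNormalized K i j := fun i j => by
      have h1 := (mulClose_entries hK hK' h i j).1.abs_sub_le
        (mul_pos (inv_pos.2 (rowSum_pos hK i)) (hK i j))
      have h2 : √(rowSum K i) * (rowSum K i)⁻¹ = (√(rowSum K i))⁻¹ := by
        rw [← div_eq_mul_inv, Real.sqrt_div_self', one_div]
      simp only [B, Matrix.of_apply, symNormalized]
      rw [abs_mul, abs_mul, abs_of_pos (hq i), abs_of_pos (inv_pos.2 (hq j)), ← h2]
      calc _ ≤ √(rowSum K i) * (θ * ((rowSum K i)⁻¹ * K i j)) * (√(rowSum K j))⁻¹ :=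
            mul_le_mul_of_nonneg_right (mul_le_mul_of_nonneg_left h1 (hq i).le)
              (inv_pos.2 (hq j)).le
        _ = _ := by ring
    have hBT : f (T ψ) - lam • T ψ =
        Matrix.toEuclideanLin B (T ψ) + (lam' - lam) • T ψ := by
      have h1 : Matrix.toEuclideanLin B (T ψ) = T (WithLp.toLp 2
          ((kernelLaplacian K).mulVec ψ.ofLp - (kernelLaplacian K').mulVec ψ.ofLp)) := by
        ext i
        rw [hT]
        change B.mulVec (T ψ).ofLp i =
          _ * ((kernelLaplacian K).mulVec ψ.ofLp - (kernelLaplacian K').mulVec ψ.ofLp) i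
        rw [← Matrix.sub_mulVec, kernelLaplacian, kernelLaplacian, sub_sub_sub_cancel_left]
        simp only [Matrix.mulVec, dotProduct, Matrix.sub_apply, Matrix.of_apply, B, hT,
          Finset.mul_sum]
        refine Finset.sum_congr rfl fun j _ => ?_
        have := (hq j).ne'
        field_simp
      rw [h1, hψ.2, hfT, WithLp.toLp_sub, WithLp.toLp_smul, map_sub, map_smul, sub_smul]
      change _ = T (WithLp.toLp 2 ((kernelLaplacian K).mulVec ψ.ofLp)) - lam' • T ψ +
        (lam' • T ψ - lam • T ψ)
      abel
    rw [hBT]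
    refine (norm_add_le _ _).trans ?_
    rw [norm_smul, Real.norm_eq_abs]
    -- One `θ` comes from `B`, the other from the Weyl shift `lam' - lam`.
    have h1 := norm_toEuclideanLin_le hK hs hθ hB (T ψ)
    have h2 := mul_le_mul_of_nonneg_right hweyl (norm_nonneg (T ψ))
    linarith
  have hTd : g * ‖T (ψ - a • φ)‖ ≤ 2 * θ * ‖T ψ‖ := by
    have h1 := norm_sub_proj_le b e f hb lam g hg.le k hgap' (T ψ)
    have h2 : T (ψ - a • φ) = T ψ - inner ℝ (b k) (T ψ) • b k := by
      rw [map_sub, map_smul]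
      conv_lhs => rw [hφ0]
      rw [smul_smul, ha, div_mul_cancel₀ _ hc0]
    rw [h2]
    exact h1.trans hres
  refine exists_sign_norm_sub_le hψ.1 hφ.1 (a := a) ?_
  -- the weights are comparable
  obtain ⟨i₀, -, hi₀⟩ := Finset.exists_min_image Finset.univ (rowSum K) ⟨k, Finset.mem_univ k⟩
  -- `T` scales norms by factors between $\sqrt{d_{\min}}$ and $\kappa\sqrt{d_{\min}}$; the common
  -- factor cancels and only `κ` survives.
  have hlow : ∀ v, √(rowSum K i₀) * ‖v‖ ≤ ‖T v‖ := fun v => by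
    refine le_of_sq_le_sq ?_ (norm_nonneg _)
    rw [mul_pow, EuclideanSpace.real_norm_sq_eq, EuclideanSpace.real_norm_sq_eq, Finset.mul_sum]
    refine Finset.sum_le_sum fun i _ => ?_
    rw [hT, mul_pow]
    exact mul_le_mul_of_nonneg_right (pow_le_pow_left₀ (Real.sqrt_nonneg _)
      (Real.sqrt_le_sqrt (hi₀ i (Finset.mem_univ i))) 2) (sq_nonneg _)
  have hup : ∀ v, ‖T v‖ ≤ κ * √(rowSum K i₀) * ‖v‖ := fun v => by
    refine le_of_sq_le_sq ?_ (by positivity)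
    rw [mul_pow, EuclideanSpace.real_norm_sq_eq, EuclideanSpace.real_norm_sq_eq, Finset.mul_sum]
    refine Finset.sum_le_sum fun i _ => ?_
    rw [hT, mul_pow, mul_pow, Real.sq_sqrt (rowSum_pos hK i).le,
      Real.sq_sqrt (rowSum_pos hK i₀).le]
    exact mul_le_mul_of_nonneg_right (hd i i₀) (sq_nonneg _)
  rw [le_div_iff₀ hg]
  refine le_of_mul_le_mul_left ?_ (hq i₀)
  have h1 := mul_le_mul_of_nonneg_left (hlow (ψ - a • φ)) hg.le
  have h2 := mul_le_mul_of_nonneg_left (hup ψ) (by positivity : 0 ≤ 2 * θ)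
  rw [hψ.1] at h2
  linarith

/-! ### Gaussian kernels of bounded point clouds -/

section Cloud

variable {p n : ℕ} {s : ℝ}

/-- The kernel takes values in $[\alpha,1]$ with $\alpha=e^{-4R^2/s^2}$, so the degrees of $A$ lie
in $[n\alpha,n]$ and those of $K$ in $[\alpha/n,\,1/(n\alpha^2)]$. Their ratio is at most
$\alpha^{-3}=e^{12R^2/s^2}$, independently of $n$. -/
theorem rowSum_normalizedAdjacency_le {x : Fin n → EuclideanSpace ℝ (Fin p)} {R : ℝ}
    (hx : ∀ i, ‖x i‖ ≤ R) (i j : Fin n) :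
    rowSum (normalizedAdjacency s x) i ≤
      (Real.exp (6 * R ^ 2 / s ^ 2)) ^ 2 * rowSum (normalizedAdjacency s x) j := by
  set α := Real.exp (-(4 * R ^ 2) / s ^ 2) with hα
  have hα0 : 0 < α := Real.exp_pos _
  have hn : (0 : ℝ) < n := by exact_mod_cast i.pos
  have hA1 : ∀ i j, adjacency s x i j ≤ 1 := fun i j => by
    rw [adjacency, Matrix.of_apply, gaussianKernel]
    refine Real.exp_le_one_iff.2 (div_nonpos_of_nonpos_of_nonneg ?_ (sq_nonneg _))
    linarith [sq_nonneg ‖x i - x j‖]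
  have hA2 : ∀ i j, α ≤ adjacency s x i j := fun i j => by
    rw [adjacency, Matrix.of_apply, gaussianKernel, hα]
    refine Real.exp_le_exp.2 (div_le_div_of_nonneg_right ?_ (sq_nonneg _))
    have h1 : ‖x i - x j‖ ≤ 2 * R := (norm_sub_le _ _).trans (by linarith [hx i, hx j])
    have := pow_le_pow_left₀ (norm_nonneg _) h1 2
    linarith
  set d : Fin n → ℝ := fun i => ∑ k, adjacency s x i k with hd
  have hd1 : ∀ i, d i ≤ n := fun i => by
    simpa using Finset.sum_le_sum fun k (_ : k ∈ Finset.univ) => hA1 i k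
  have hd2 : ∀ i, n * α ≤ d i := fun i => by
    simpa using Finset.sum_le_sum fun k (_ : k ∈ Finset.univ) => hA2 i k
  have hd0 : ∀ i, 0 < d i := fun i => (by positivity : 0 < n * α).trans_le (hd2 i)
  have hK : ∀ i j, normalizedAdjacency s x i j = (d i)⁻¹ * adjacency s x i j * (d j)⁻¹ :=
    fun i j => normalizedAdjacency_apply s x i j
  have hup : rowSum (normalizedAdjacency s x) i ≤ n * ((n * α)⁻¹ * 1 * (n * α)⁻¹) := by
    rw [rowSum]
    simp only [hK]
    refine (Finset.sum_le_sum (g := fun _ => (n * α)⁻¹ * 1 * (n * α)⁻¹) fun k _ => ?_).trans_eq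
      (by simp)
    refine mul_le_mul (mul_le_mul (inv_anti₀ (by positivity) (hd2 i)) (hA1 i k)
      ((hα0.le).trans (hA2 i k)) (by positivity)) (inv_anti₀ (by positivity) (hd2 k))
      (inv_pos.2 (hd0 k)).le (by positivity)
  have hlow : n * ((n : ℝ)⁻¹ * α * (n : ℝ)⁻¹) ≤ rowSum (normalizedAdjacency s x) j := by
    rw [rowSum]
    simp only [hK]
    refine Eq.trans_le (by simp) (Finset.sum_le_sum (f := fun _ => (n : ℝ)⁻¹ * α * (n : ℝ)⁻¹)
      fun k _ => ?_)
    refine mul_le_mul (mul_le_mul (inv_anti₀ (hd0 j) (hd1 j)) (hA2 j k) hα0.le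
      (inv_pos.2 (hd0 j)).le) (inv_anti₀ (hd0 k) (hd1 k)) (by positivity) ?_
    exact mul_nonneg (inv_pos.2 (hd0 j)).le (hα0.le.trans (hA2 j k))
  have hexp : Real.exp (6 * R ^ 2 / s ^ 2) ^ 2 = (α ^ 3)⁻¹ := by
    rw [hα, ← Real.exp_nat_mul, ← Real.exp_nat_mul, ← Real.exp_neg]
    congr 1
    push_cast
    ring
  refine hup.trans (le_trans (le_of_eq ?_) (mul_le_mul_of_nonneg_left hlow (sq_nonneg _)))
  rw [hexp]
  field_simp

/-- One $t$ for the entry of $A$ and one for each of the two degrees. -/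
theorem mulClose_normalizedAdjacency {x x' : Fin n → EuclideanSpace ℝ (Fin p)} {t : ℝ}
    (h : ∀ i j, MulClose t (adjacency s x i j) (adjacency s x' i j)) (i j : Fin n) :
    MulClose (3 * t) (normalizedAdjacency s x i j) (normalizedAdjacency s x' i j) := by
  have hp := adjacency_pos s x
  have hp' := adjacency_pos s x'
  have hd : ∀ i, MulClose t (rowSum (adjacency s x) i) (rowSum (adjacency s x') i) := fun i =>
    MulClose.sum _ fun j _ => h i j
  have hi := fun i => inv_pos.2 (rowSum_pos hp i)
  have hi' := fun i => inv_pos.2 (rowSum_pos hp' i)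
  have hinv := fun i => (hd i).inv (rowSum_pos hp i) (rowSum_pos hp' i)
  have := ((hinv i).mul (h i j) (hi i) (hi' i) (hp i j) (hp' i j)).mul (hinv j)
    (mul_pos (hi i) (hp i j)) (mul_pos (hi' i) (hp' i j)) (hi j) (hi' j)
  rw [normalizedAdjacency_apply, normalizedAdjacency_apply]
  have e : t + t + t = 3 * t := by ring
  rwa [e] at this

theorem mulClose_adjacency {x η : Fin n → EuclideanSpace ℝ (Fin p)} {R ρ : ℝ}
    (hx : ∀ i, ‖x i‖ ≤ R) (hη : ∀ i, ‖η i‖ ≤ ρ) (hρ1 : ρ ≤ 1) (i j : Fin n) :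
    MulClose (2 * (4 * R + 2) / s ^ 2 * ρ) (adjacency s x i j)
      (adjacency s (fun i => x i + η i) i j) := by
  have hρ : 0 ≤ ρ := (norm_nonneg _).trans (hη i)
  have hR : 0 ≤ R := (norm_nonneg _).trans (hx i)
  apply MulClose.exp
  rw [← sub_div, abs_div, abs_of_nonneg (sq_nonneg s), div_mul_eq_mul_div]
  refine div_le_div_of_nonneg_right ?_ (sq_nonneg s)
  have h1 : ‖x i - x j‖ ≤ 2 * R := (norm_sub_le _ _).trans (by linarith [hx i, hx j])
  have h2 : ‖η i - η j‖ ≤ 2 * ρ := (norm_sub_le _ _).trans (by linarith [hη i, hη j])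
  have h3 : x i + η i - (x j + η j) = (x i - x j) + (η i - η j) := by abel
  have h4 : |‖x i + η i - (x j + η j)‖ - ‖x i - x j‖| ≤ 2 * ρ := by
    refine (abs_norm_sub_norm_le _ _).trans ?_
    rwa [h3, add_sub_cancel_left]
  have h5 : ‖x i + η i - (x j + η j)‖ ≤ 2 * R + 2 * ρ := by
    rw [h3]
    exact (norm_add_le _ _).trans (add_le_add h1 h2)
  -- Difference of squares: the first factor is at most $2\rho$, the second at most $4R+2\rho\le
  -- 4R+2$.
  have h6 : -‖x i - x j‖ ^ 2 - -‖x i + η i - (x j + η j)‖ ^ 2 =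
      (‖x i + η i - (x j + η j)‖ - ‖x i - x j‖) * (‖x i + η i - (x j + η j)‖ + ‖x i - x j‖) := by
    ring
  rw [h6, abs_mul, abs_of_nonneg (by positivity :
    0 ≤ ‖x i + η i - (x j + η j)‖ + ‖x i - x j‖)]
  calc _ ≤ 2 * ρ * (4 * R + 2) := mul_le_mul h4 (by linarith) (by positivity) (by positivity)
    _ = _ := by ring

/-- Eigenvectors of the clean and the noisy Laplacian under small bounded noise. -/
theorem exists_sign_rwLaplacian_eigenvector_sub_le {x η : Fin n → EuclideanSpace ℝ (Fin p)}
    {R ρ g : ℝ} (hx : ∀ i, ‖x i‖ ≤ R) (hη : ∀ i, ‖η i‖ ≤ ρ) (hρ1 : ρ ≤ 1)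
    (hsmall : 6 * (2 * (4 * R + 2) / s ^ 2 * ρ) ≤ 1) (k : Fin n) (hg : 0 < g)
    (hgap : ∀ j, j ≠ k → g ≤ |nthEigenvalue (rwLaplacian s x) (j + 1) -
      nthEigenvalue (rwLaplacian s x) (k + 1)|)
    {ψ φ : EuclideanSpace ℝ (Fin n)}
    (hψ : IsUnitEigenvector (rwLaplacian s fun i => x i + η i)
      (nthEigenvalue (rwLaplacian s fun i => x i + η i) (k + 1)) ψ)
    (hφ : IsUnitEigenvector (rwLaplacian s x) (nthEigenvalue (rwLaplacian s x) (k + 1)) φ) :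
    ∃ τ : ℝ, (τ = 1 ∨ τ = -1) ∧ ‖ψ - τ • φ‖ ≤
      96 * (4 * R + 2) / s ^ 2 * Real.exp (6 * R ^ 2 / s ^ 2) * (ρ / g) := by
  have hρ : 0 ≤ ρ := (norm_nonneg _).trans (hη k)
  have hR : 0 ≤ R := (norm_nonneg _).trans (hx k)
  set t := 2 * (4 * R + 2) / s ^ 2 * ρ with ht
  have ht0 : 0 ≤ t := by positivity
  rw [rwLaplacian_eq_kernelLaplacian] at hψ hφ hgap
  obtain ⟨τ, hτ, hle⟩ := exists_sign_eigenvector_sub_le (normalizedAdjacency_pos s x)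
    (normalizedAdjacency_comm s x) (normalizedAdjacency_pos s fun i => x i + η i)
    (normalizedAdjacency_comm s fun i => x i + η i) (by positivity : 0 ≤ 3 * t)
    (mulClose_normalizedAdjacency (mulClose_adjacency hx hη hρ1)) (Real.exp_pos _).le
    (rowSum_normalizedAdjacency_le hx) k hg hgap hψ hφ
  refine ⟨τ, hτ, hle.trans ?_⟩
  have h6 : 2 * (3 * t) = 6 * t := by ring
  -- Uses $|e^x-1|\le 2|x|$ for $|x|\le 1$ at $x=6t$; this is where `hsmall` enters. The constant is
  -- $96=2\cdot2\cdot12\cdot2$.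
  have hθ : Real.exp (2 * (3 * t)) - 1 ≤ 12 * t := by
    have := Real.abs_exp_sub_one_le (x := 6 * t) (by rwa [abs_of_nonneg (by positivity)])
    rw [abs_of_nonneg (by positivity : 0 ≤ 6 * t)] at this
    rw [h6]
    linarith [le_abs_self (Real.exp (6 * t) - 1)]
  calc _ ≤ 2 * (2 * (12 * t) * Real.exp (6 * R ^ 2 / s ^ 2) / g) := by gcongr
    _ = _ := by rw [ht]; ring

end Cloud

end NoisyLaplacian

namespace NoisyLaplacian

/-! ### Concentration of the noise -/

section Noise

variable {Ω : Type*} [MeasurableSpace Ω] {P : Measure Ω} {p : ℕ}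

theorem IsSubGaussianVector.hasSubgaussianMGF_coord {X : Ω → EuclideanSpace ℝ (Fin p)} {ε : ℝ}
    (hX : IsSubGaussianVector X ε 0 P) (v : NNReal) (hv : ε ^ 2 ≤ v) (k : Fin p) :
    HasSubgaussianMGF (fun ω => X ω k) v P := by
  have hin : ∀ (t : ℝ) (ω : Ω),
      inner ℝ (t • EuclideanSpace.single k (1 : ℝ)) (X ω - 0) = t * X ω k := fun t ω => by
    rw [sub_zero, real_inner_smul_left, EuclideanSpace.inner_single_left]
    simp
  refine ⟨fun t => ?_, fun t => ?_⟩
  · simpa only [hin] using hX.integrable_exp (t • EuclideanSpace.single k (1 : ℝ))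
  · have h := hX.integral_exp_le (t • EuclideanSpace.single k (1 : ℝ))
    simp only [hin] at h
    refine h.trans (Real.exp_le_exp.2 ?_)
    have : ‖t • EuclideanSpace.single k (1 : ℝ)‖ ^ 2 = t ^ 2 := by
      rw [norm_smul, PiLp.norm_single, norm_one, mul_one, Real.norm_eq_abs, sq_abs]
    rw [this, mul_comm (v : ℝ)]
    gcongr

/-- A crude triangle inequality; losing a factor $p$ is harmless since $p$ is fixed. -/
theorem norm_le_card_mul {x : EuclideanSpace ℝ (Fin p)} {u : ℝ} (h : ∀ k, |x k| ≤ u) :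
    ‖x‖ ≤ p * u := by
  rw [← (EuclideanSpace.basisFun (Fin p) ℝ).sum_repr x]
  refine (norm_sum_le _ _).trans ((Finset.sum_le_sum (g := fun _ => u) fun k _ => ?_).trans_eq
    (by simp))
  rw [norm_smul, OrthonormalBasis.norm_eq_one, mul_one]
  simpa using h k

/-- A union bound for the largest noise vector. -/
theorem measureReal_exists_norm_gt_le [IsProbabilityMeasure P] {n : ℕ}
    {η : Fin n → Ω → EuclideanSpace ℝ (Fin p)} {ε : ℝ}
    (hη : ∀ i, IsSubGaussianVector (η i) ε 0 P) {v u : ℝ} (hv : ε ^ 2 ≤ v) (hu : 0 ≤ u) :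
    P.real {ω | ∀ i, ‖η i ω‖ ≤ p * u}ᶜ ≤ n * (p * (2 * Real.exp (-u ^ 2 / (2 * v)))) := by
  lift v to NNReal using (sq_nonneg ε).trans hv
  -- If some noise vector is too long, one of its coordinates reaches $u$ in absolute value; the two
  -- signs account for the factor 2.
  have hsub : {ω | ∀ i, ‖η i ω‖ ≤ p * u}ᶜ ⊆
      ⋃ i, ⋃ k, ({ω | u ≤ η i ω k} ∪ {ω | u ≤ (-fun ω => η i ω k) ω}) := by
    intro ω hω
    by_contra hcon
    simp only [Set.mem_iUnion, Set.mem_union, Set.mem_ofPred_eq, Pi.neg_apply, not_exists, not_or,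
      not_le] at hcon
    exact hω fun i => norm_le_card_mul fun k =>
      abs_le.2 ⟨by linarith [(hcon i k).2], (hcon i k).1.le⟩
  refine (measureReal_mono hsub).trans ((measureReal_iUnion_fintype_le _).trans ?_)
  refine (Finset.sum_le_sum (g := fun _ => p * (2 * Real.exp (-u ^ 2 / (2 * v)))) fun i _ =>
    ?_).trans_eq (by simp)
  refine (measureReal_iUnion_fintype_le _).trans ?_
  refine (Finset.sum_le_sum (g := fun _ => 2 * Real.exp (-u ^ 2 / (2 * v))) fun k _ =>
    ?_).trans_eq (by simp)
  have h := (hη i).hasSubgaussianMGF_coord v hv k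
  refine (measureReal_union_le _ _).trans ?_
  linarith [h.measure_ge_le hu, h.neg.measure_ge_le hu]

end Noise

/-- With variance proxy `O(1 / √(n log n))`, all noise vectors are `O(n^{-1/2})` simultaneously. -/
theorem measureReal_noise_compl_le {Ω : Type*} [MeasurableSpace Ω] {P : Measure Ω}
    [IsProbabilityMeasure P] {p n : ℕ} (hn : 2 ≤ n) {η : Fin n → Ω → EuclideanSpace ℝ (Fin p)}
    {ε c : ℝ} (hε0 : 0 ≤ ε) (hc : 0 < c) (hε : ε < √c / √((n : ℝ) * Real.log n))
    (hη : ∀ i, IsSubGaussianVector (η i) ε 0 P) :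
    P.real {ω | ∀ i, ‖η i ω‖ ≤ p * (2 * √c * (n : ℝ) ^ (-(1 / 2) : ℝ))}ᶜ ≤ 2 * p / n := by
  have hn0 : (0 : ℝ) < n := by positivity
  have hlog : 0 < Real.log n := Real.log_pos (by exact_mod_cast hn)
  -- This positive bound replaces `ε ^ 2` in the tail exponent, which also covers `ε = 0`.
  have hv : ε ^ 2 ≤ c / (n * Real.log n) := by
    have := pow_le_pow_left₀ hε0 hε.le 2
    rwa [div_pow, Real.sq_sqrt hc.le, Real.sq_sqrt (by positivity)] at this
  refine (measureReal_exists_norm_gt_le hη hv (by positivity)).trans_eq ?_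
  have hsq : ((n : ℝ) ^ (-(1 / 2) : ℝ)) ^ 2 = (n : ℝ)⁻¹ := by
    rw [← Real.rpow_natCast, ← Real.rpow_mul hn0.le]
    norm_num [Real.rpow_neg_one]
  -- The factor 2 in the radius makes each tail $2n^{-2}$, so that $np$ of them still sum to $2p/n$.
  have harg : -(2 * √c * (n : ℝ) ^ (-(1 / 2) : ℝ)) ^ 2 / (2 * (c / (n * Real.log n))) =
      -(2 * Real.log n) := by
    rw [mul_pow, mul_pow, hsq, Real.sq_sqrt hc.le]
    field_simp
  rw [harg, Real.exp_neg, two_mul (Real.log n), Real.exp_add, Real.exp_log hn0]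
  field_simp

/-! ### Isolation of an eigenvalue from its neighbouring gaps -/

/-- A common lower bound for the gaps of the `i`-th eigenvalue to all others. -/
theorem exists_gap {p : ℕ} {s : ℝ} (y : (n : ℕ) → Fin n → EuclideanSpace ℝ (Fin p)) (m : ℕ)
    (hgap : ∀ i, 1 ≤ i → i < m →
      (fun n : ℕ => (n : ℝ) ^ (-(1 / 2) : ℝ)) =o[atTop] fun n : ℕ =>
        |nthEigenvalue (rwLaplacian s (y n)) i - nthEigenvalue (rwLaplacian s (y n)) (i + 1)|)
    (k : ℕ) (hk : k + 1 < m) :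
    ∃ g : ℕ → ℝ, (fun n : ℕ => (n : ℝ) ^ (-(1 / 2) : ℝ)) =o[atTop] g ∧ (∀ n, 0 ≤ g n) ∧
      ∀ n, ∀ j i : Fin n, (i : ℕ) = k → j ≠ i →
        g n ≤ |nthEigenvalue (rwLaplacian s (y n)) (j + 1) -
          nthEigenvalue (rwLaplacian s (y n)) (i + 1)| := by
  set G : ℕ → ℕ → ℝ := fun i n =>
    |nthEigenvalue (rwLaplacian s (y n)) i - nthEigenvalue (rwLaplacian s (y n)) (i + 1)| with hG
  have hmono : ∀ n, ∀ a b : Fin n, a ≤ b → nthEigenvalue (rwLaplacian s (y n)) (a + 1) ≤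
      nthEigenvalue (rwLaplacian s (y n)) (b + 1) := fun n a b hab => by
    obtain ⟨e, -, he, -, hn⟩ := exists_sorted_eigenbasis _
      (isHermitian_one_sub_symNormalized (normalizedAdjacency_comm s (y n)))
    rw [rwLaplacian_eq_kernelLaplacian,
      nthEigenvalue_kernelLaplacian (normalizedAdjacency_pos s (y n)),
      nthEigenvalue_kernelLaplacian (normalizedAdjacency_pos s (y n)), hn, hn]
    exact he hab
  have hright : ∀ n, ∀ j i : Fin n, i < j → G (i + 1) n ≤
      |nthEigenvalue (rwLaplacian s (y n)) (j + 1) -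
        nthEigenvalue (rwLaplacian s (y n)) (i + 1)| := fun n j i hij => by
    have hlt : (i : ℕ) + 1 < n := lt_of_le_of_lt (Nat.succ_le_of_lt hij) j.2
    have h1 := hmono n i ⟨i + 1, hlt⟩ (by simp [Fin.le_def])
    have h2 := hmono n ⟨i + 1, hlt⟩ j (by simpa [Fin.le_def] using hij)
    simp only [hG]
    rw [abs_sub_comm]
    rw [abs_of_nonneg (sub_nonneg.2 h1), abs_of_nonneg (sub_nonneg.2 (h1.trans h2))]
    exact sub_le_sub_right h2 _
  have hleft : ∀ n, ∀ j i : Fin n, j < i → G i n ≤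
      |nthEigenvalue (rwLaplacian s (y n)) (j + 1) -
        nthEigenvalue (rwLaplacian s (y n)) (i + 1)| := fun n j i hij => by
    have hi : (i : ℕ) - 1 + 1 = i := Nat.sub_add_cancel (by have : (j : ℕ) < i := hij; omega)
    have h1 := hmono n j ⟨i - 1, by omega⟩ (by have : (j : ℕ) < i := hij; simp [Fin.le_def]; omega)
    have h2 := hmono n ⟨i - 1, by omega⟩ i (by simp [Fin.le_def])
    simp only [hi] at h1 h2
    simp only [hG]
    rw [abs_sub_comm, abs_sub_comm (nthEigenvalue (rwLaplacian s (y n)) (j + 1)),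
      abs_of_nonneg (sub_nonneg.2 h2), abs_of_nonneg (sub_nonneg.2 (h1.trans h2))]
    exact sub_le_sub_left h1 _
  -- By monotonicity only the adjacent eigenvalues matter. The first one has no left neighbour, and
  -- `G 0` would be useless: by truncated subtraction the indices 0 and 1 name the same eigenvalue,
  -- so it is zero.
  rcases Nat.eq_zero_or_pos k with rfl | hk0
  · refine ⟨G 1, hgap 1 le_rfl hk, fun n => abs_nonneg _, fun n j i hi hji => ?_⟩
    have hij : i < j := by
      rw [Fin.lt_def]
      have := Fin.val_ne_of_ne hji
      omega
    simpa only [hi] using hright n j i hij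
  · refine ⟨fun n => min (G k n) (G (k + 1) n), ?_, fun n => le_min (abs_nonneg _) (abs_nonneg _),
      fun n j i hi hji => ?_⟩
    · refine isLittleO_iff.2 fun a ha => ?_
      filter_upwards [isLittleO_iff.1 (hgap k hk0 (by omega)) ha,
        isLittleO_iff.1 (hgap (k + 1) (by omega) hk) ha] with n h1 h2
      rcases min_choice (G k n) (G (k + 1) n) with h | h <;> rw [h] <;> assumption
    · rcases lt_or_gt_of_ne hji with h | h
      · refine (min_le_left _ _).trans ?_
        have := hleft n j i h
        rwa [hi] at this ⊢
      · refine (min_le_right _ _).trans ?_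
        have := hright n j i h
        rwa [hi] at this ⊢

end NoisyLaplacian

/-! ### Combination of the noise bound with the eigenvector perturbation -/

theorem mainTheorem6 {p : ℕ} (s : ℝ) (hs : 0 < s)
    -- clean data in a bounded region of `ℝ^p`; for each `n`, a sample of size `n`
    (R : ℝ) (y : (n : ℕ) → Fin n → EuclideanSpace ℝ (Fin p))
    (hy : ∀ n i, ‖y n i‖ ≤ R)
    -- i.i.d. centered sub-Gaussian noise
    {Ω : ℕ → Type*} [∀ n, MeasurableSpace (Ω n)] (P : (n : ℕ) → Measure (Ω n))
    [∀ n, IsProbabilityMeasure (P n)]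
    (η : (n : ℕ) → Fin n → Ω n → EuclideanSpace ℝ (Fin p))
    (hη_meas : ∀ n i, Measurable (η n i))
    (hη_indep : ∀ n, iIndepFun (η n) (P n))
    (hη_ident : ∀ n i j, IdentDistrib (η n i) (η n j) (P n) (P n))
    (ε : ℕ → ℝ) (hε_nonneg : ∀ n, 0 ≤ ε n)
    (hη_subG : ∀ n i, NoisyLaplacian.IsSubGaussianVector (η n i) (ε n) 0 (P n))
    (c : ℝ) (hc : 0 < c)
    (hε : ∀ n : ℕ, 2 ≤ n → ε n < √c / √((n : ℝ) * Real.log n))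
    -- the gaps between the first `m` clean eigenvalues are `ω(n^{-1/2})`
    (m : ℕ)
    (hgap : ∀ i, 1 ≤ i → i < m →
      (fun n : ℕ => (n : ℝ) ^ (-(1 / 2) : ℝ)) =o[atTop] fun n : ℕ =>
        |NoisyLaplacian.nthEigenvalue (NoisyLaplacian.rwLaplacian s (y n)) i -
          NoisyLaplacian.nthEigenvalue (NoisyLaplacian.rwLaplacian s (y n)) (i + 1)|) :
    ∀ i, 1 ≤ i → i < m →
      ∃ (δ : ℕ → ℝ) (E : (n : ℕ) → Set (Ω n)),
        Tendsto δ atTop (𝓝 0) ∧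
        (∀ n, MeasurableSet (E n)) ∧
        Tendsto (fun n => P n (E n)) atTop (𝓝 1) ∧
        ∀ n, ∀ ω ∈ E n, ∀ ψ ψbar : EuclideanSpace ℝ (Fin n),
          NoisyLaplacian.IsUnitEigenvector
            (NoisyLaplacian.rwLaplacian s fun j => y n j + η n j ω)
            (NoisyLaplacian.nthEigenvalue
              (NoisyLaplacian.rwLaplacian s fun j => y n j + η n j ω) i) ψ →
          NoisyLaplacian.IsUnitEigenvector
            (NoisyLaplacian.rwLaplacian s (y n))
            (NoisyLaplacian.nthEigenvalue (NoisyLaplacian.rwLaplacian s (y n)) i) ψbar →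
          ∃ τ : ℝ, (τ = 1 ∨ τ = -1) ∧ ‖ψ - τ • ψbar‖ ≤ δ n := by

  intro i hi him
  obtain ⟨k, rfl⟩ : ∃ k, i = k + 1 := ⟨i - 1, by omega⟩
  obtain ⟨g, hgo, hg0, hgle⟩ := NoisyLaplacian.exists_gap y m hgap k him
  set r : ℕ → ℝ := fun n => (n : ℝ) ^ (-(1 / 2) : ℝ) with hr
  set ρ : ℕ → ℝ := fun n => p * (2 * √c * r n) with hρ
  have hr0 : Tendsto r atTop (𝓝 0) :=
    (tendsto_rpow_neg_atTop (by norm_num : (0 : ℝ) < 1 / 2)).comp tendsto_natCast_atTop_atTop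
  have hρ0 : Tendsto ρ atTop (𝓝 0) := by
    simpa using (hr0.const_mul (2 * √c)).const_mul (p : ℝ)
  set C : ℝ := 96 * (4 * R + 2) / s ^ 2 * Real.exp (6 * R ^ 2 / s ^ 2)
  have hgood : ∀ᶠ n : ℕ in atTop, 2 ≤ n ∧ k < n ∧ ρ n ≤ 1 ∧
      6 * (2 * (4 * R + 2) / s ^ 2 * ρ n) ≤ 1 ∧ 0 < g n := by
    have hlim : Tendsto (fun n => 6 * (2 * (4 * R + 2) / s ^ 2 * ρ n)) atTop (𝓝 0) := by
      simpa using (hρ0.const_mul (2 * (4 * R + 2) / s ^ 2)).const_mul 6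
    filter_upwards [eventually_ge_atTop 2, eventually_gt_atTop k,
      hρ0.eventually_le_const zero_lt_one, hlim.eventually_le_const zero_lt_one,
      -- Constant 1 in the little-o relation gives $n^{-1/2}\le g$, hence $g>0$.
      isLittleO_iff.1 hgo zero_lt_one] with n h2 hk h3 h4 h5
    refine ⟨h2, hk, h3, h4, ?_⟩
    have hrn : 0 < r n := Real.rpow_pos_of_pos (by positivity) _
    rw [one_mul, Real.norm_eq_abs, Real.norm_eq_abs, abs_of_pos hrn, abs_of_nonneg (hg0 n)] at h5
    exact hrn.trans_le h5
  classical
  set Good : ℕ → Prop := fun n => 2 ≤ n ∧ k < n ∧ ρ n ≤ 1 ∧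
      6 * (2 * (4 * R + 2) / s ^ 2 * ρ n) ≤ 1 ∧ 0 < g n with hGood
  have hmeas : ∀ n, MeasurableSet {ω | ∀ i, ‖η n i ω‖ ≤ ρ n} := fun n => by
    rw [Set.ofPred_forall]
    exact MeasurableSet.iInter fun i => measurableSet_le (hη_meas n i).norm measurable_const
  -- For the finitely many `n` that are not good the event is empty: the claim is vacuous there and
  -- the limit of the probabilities is unaffected.
  refine ⟨fun n => C * (ρ n / g n), fun n => if Good n then {ω | ∀ i, ‖η n i ω‖ ≤ ρ n} else ∅,
    ?_, fun n => ?_, ?_, fun n ω hω ψ φ hψ hφ => ?_⟩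
  · have h := ((hgo.tendsto_div_nhds_zero.const_mul (2 * √c)).const_mul (p : ℝ)).const_mul C
    simp only [mul_zero] at h
    refine h.congr fun n => ?_
    simp only [hρ]
    ring
  · beta_reduce
    split_ifs
    · exact hmeas n
    · exact MeasurableSet.empty
  · rw [← ENNReal.tendsto_toReal_iff (fun n => measure_ne_top _ _) ENNReal.one_ne_top,
      ENNReal.toReal_one]
    have hlow : Tendsto (fun n : ℕ => 1 - 2 * (p : ℝ) / n) atTop (𝓝 1) := by
      simpa using (tendsto_const_div_atTop_nhds_zero_nat (2 * (p : ℝ))).const_sub 1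
    refine tendsto_of_tendsto_of_tendsto_of_le_of_le' hlow tendsto_const_nhds ?_
      (Eventually.of_forall fun n => measureReal_le_one)
    filter_upwards [hgood] with n hn
    have h1 := NoisyLaplacian.measureReal_noise_compl_le hn.1 (hε_nonneg n) hc (hε n hn.1)
      (hη_subG n)
    change _ ≤ (P n).real (if Good n then {ω | ∀ i, ‖η n i ω‖ ≤ ρ n} else ∅)
    rw [if_pos hn]
    rw [probReal_compl_eq_one_sub (hmeas n)] at h1
    linarith
  · beta_reduce at hω
    by_cases hn : Good n
    · rw [if_pos hn] at hω
      obtain ⟨-, hkn, hρ1, hsmall, hgn⟩ := hn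
      exact NoisyLaplacian.exists_sign_rwLaplacian_eigenvector_sub_le (hy n) hω hρ1 hsmall
        ⟨k, hkn⟩ hgn (fun j hj => hgle n j ⟨k, hkn⟩ rfl hj) hψ hφ
    · rw [if_neg hn] at hω
      exact hω.elim
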